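/- For a locally compact second countable Hausdorff space $L$ and $t>0$ let $\mathscr C_t^{L}$ be the set of closed subsets of $[0,t]\times L$ with the Borel $\sigma$-field $\Sigma_t$ of the Fell topology. For $s,t>0$ let $\oplus_{s,t}(Z_1,Z_2)=Z_1\cup\{(s+r,\ell):(r,\ell)\in Z_2\}$ be concatenation $\mathscr C_s^{L}\times\mathscr C_t^{L}\to\mathscr C_{s+t}^{L}$, and let $\sigma_t:\mathscr C_t^{L}\to\mathscr C_1^{L}$, $\sigma_t(Z)=\{(r/t,\ell):(r,\ell)\in Z\}$. A family $\{\mu_t\}_{t>0}$ of probability measures $\mu_t$ on $\mathscr C_t^{L}$ is a *measurable factorizing family over* $[0,1]\times L$ if: (i) $\mu_{s+t}$ and $(\mu_s\otimes\mu_t)\circ\oplus_{s,t}^{-1}$ are mutually absolutely continuous for all $s,t>0$; (ii) $\mu_t(\{Z: Z\cap(\{r\}\times L)\ne\varnothing\})=0$ for all $t>0$, $r\in[0,t]$; (iii) no $\mu_t$ is supported on finitely many atoms; (iv-a) there is a countable ring $\mathcal R\subset\Sigma_1$ generating $\Sigma_1$ such that $t\mapsto((\sigma_t)_*\mu_t)(A)$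 is Borel on $(0,\infty)$ for every $A\in\mathcal R$; (iv-b) there is a Borel map $\Delta:(0,\infty)^2\times\mathscr C_1^{L}\to(0,\infty)$ such that for all $s,t>0$, $\Delta(s,t,\sigma_{s+t}(Z))=\dfrac{d((\mu_s\otimes\mu_t)\circ\oplus_{s,t}^{-1})}{d\mu_{s+t}}(Z)$ for $\mu_{s+t}$-a.e. $Z$. Let $\{*\}$ be a one-point space and let $\boldsymbol\nu=\{\nu_t\}_{t>0}$ be a measurable factorizing family over $[0,1]\times\{*\}$ (for instance a seed, that is, one whose associated Arveson system is of type $\mathrm{II}_0$). Assume that $\boldsymbol\nu$ is Hellinger-small: for all $s,t>0$ there is a finite constant $C_{s,t}$ such that for all sufficiently small $\lambda>0$ $$1-H_{\lambda s,\lambda t}\le C_{s,t}\,\lambda^2,\qquad H_{s,t}=\int\sqrt{\frac{d\nu_{s+t}}{d\sigma_{s,t}}}\;d\sigma_{s,t},\quad \sigma_{s,t}=(\nu_s\otimes\nu_t)\circ\oplus_{s,t}^{-1}.$$ Let $(a_n)$ be a sequence of positive reals with $\sum_n a_n^2<\infty$. For each $n$ and $t>0$ let $\nu_t^{(n)}$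 be the image of $\nu_{a_nt}$ under the dilation $Z\mapsto\{(u/a_n,*):(u,*)\in Z\}$ from $\mathscr C_{a_nt}^{\{*\}}$ to $\mathscr C_t^{\{*\}}$, and let $\mu_t$ be the law on $\mathscr C_t^{\mathbb N}$ of the random closed set $\bigcup_n Z^{(n)}\times\{n\}$, where $(Z^{(n)})_n$ has law $\bigotimes_n\nu_t^{(n)}$ and each $Z^{(n)}$ is regarded as a closed subset of $[0,t]$. Then $\{\mu_t\}_{t>0}$ is a measurable factorizing family over $[0,1]\times\mathbb N$; in particular each $\mu_{s+t}$ is equivalent to $(\mu_s\otimes\mu_t)\circ\oplus_{s,t}^{-1}$. -/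

import Mathlib

open MeasureTheory

noncomputable section

/-- The time set `(0, ∞)`, with the addition and multiplication of real numbers. -/
abbrev PosReal : Type := {x : ℝ // 0 < x}

/-- Closed subsets of `[0,t] × L`, i.e. closed subsets of `ℝ × L` contained in `[0,t] × L`. -/
@[ext]
structure ClosedSets (L : Type*) [TopologicalSpace L] (t : PosReal) where
  carrier : Set (ℝ × L)
  isClosed' : IsClosed carrier
  subset' : carrier ⊆ Set.Icc (0 : ℝ) (t : ℝ) ×ˢ Set.univ

namespace ClosedSets

variable {L : Type*} [TopologicalSpace L]

/-- The Fell (hit-or-miss) topology. The open subsets of `[0,t] × L` are the traces of open subsets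
of `ℝ × L`, and a closed subset of `[0,t] × L` hits such a trace iff it hits the ambient open set;
similarly for compact sets. -/
instance instFellTopology (t : PosReal) : TopologicalSpace (ClosedSets L t) :=
  TopologicalSpace.generateFrom
    ({H | ∃ O : Set (ℝ × L), IsOpen O ∧ H = {F : ClosedSets L t | (F.carrier ∩ O).Nonempty}} ∪
     {M | ∃ K : Set (ℝ × L), IsCompact K ∧ M = {F : ClosedSets L t | F.carrier ∩ K = ∅}})

/-- The Borel σ-field of the Fell topology. -/
instance instMeasurableSpace (t : PosReal) : MeasurableSpace (ClosedSets L t) :=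
  borel (ClosedSets L t)

instance instBorelSpace (t : PosReal) : BorelSpace (ClosedSets L t) := ⟨rfl⟩

/-- The time change `Z ↦ {((t/s) r, ℓ) : (r, ℓ) ∈ Z}` from closed subsets of `[0,s] × L` to closed
subsets of `[0,t] × L`. -/
def rescale (s t : PosReal) (Z : ClosedSets L s) : ClosedSets L t where
  carrier := (fun p : ℝ × L => ((t : ℝ) / (s : ℝ) * p.1, p.2)) '' Z.carrier
  isClosed' := by
    have hc : (t : ℝ) / (s : ℝ) ≠ 0 := (div_pos t.2 s.2).ne'
    exact (((Homeomorph.mulLeft₀ _ hc).prodCongr (Homeomorph.refl L)).isClosed_image).2 Z.isClosed'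
  subset' := by
    rintro _ ⟨p, hp, rfl⟩
    have h := (Z.subset' hp).1
    have hs := s.2
    have ht := t.2
    refine ⟨⟨mul_nonneg (div_pos ht hs).le h.1, ?_⟩, trivial⟩
    calc (t : ℝ) / (s : ℝ) * p.1 ≤ (t : ℝ) / (s : ℝ) * (s : ℝ) :=
          mul_le_mul_of_nonneg_left h.2 (div_pos ht hs).le
      _ = (t : ℝ) := div_mul_cancel₀ _ hs.ne'

/-- The concatenation map `(Z₁, Z₂) ↦ Z₁ ∪ (s + Z₂)`. -/
def concat (s t : PosReal) (Z : ClosedSets L s × ClosedSets L t) : ClosedSets L (s + t) where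
  carrier := Z.1.carrier ∪ (fun p : ℝ × L => ((s : ℝ) + p.1, p.2)) '' Z.2.carrier
  isClosed' := Z.1.isClosed'.union
    ((((Homeomorph.addLeft (s : ℝ)).prodCongr (Homeomorph.refl L)).isClosed_image).2 Z.2.isClosed')
  subset' := by
    have hs := s.2
    have ht := t.2
    rintro p (hp | ⟨q, hq, rfl⟩)
    · have h := (Z.1.subset' hp).1
      exact ⟨⟨h.1, h.2.trans (le_add_of_nonneg_right ht.le)⟩, trivial⟩
    · have h := (Z.2.subset' hq).1
      exact ⟨⟨add_nonneg hs.le h.1, add_le_add_right h.2 _⟩, trivial⟩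

/-- The map `(Zₙ)ₙ ↦ ⋃ₙ Zₙ × {n}` from sequences of closed subsets of `[0,t]` to closed subsets
of `[0,t] × ℕ`. -/
def assemble (t : PosReal) (Z : ℕ → ClosedSets Unit t) : ClosedSets ℕ t where
  carrier := {p | (p.1, ()) ∈ (Z p.2).carrier}
  isClosed' := by
    rw [← isOpen_compl_iff]
    have h : {p : ℝ × ℕ | (p.1, ()) ∈ (Z p.2).carrier}ᶜ =
        ⋃ n : ℕ, {x : ℝ | (x, ()) ∉ (Z n).carrier} ×ˢ ({n} : Set ℕ) := by
      ext ⟨x, n⟩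
      simp
    rw [h]
    refine isOpen_iUnion fun n => IsOpen.prod ?_ (isOpen_discrete _)
    exact (Z n).isClosed'.isOpen_compl.preimage (Continuous.prodMk_left ())
  subset' := fun p hp => ⟨((Z p.2).subset' hp).1, trivial⟩

end ClosedSets

open ClosedSets

/-- Mutual absolute continuity of measures. -/
def MeasEquiv {X : Type*} [MeasurableSpace X] (μ ν : Measure X) : Prop := μ ≪ ν ∧ ν ≪ μ

section Families

variable {L : Type*} [TopologicalSpace L]

/-- The law `(μ_s ⊗ μ_t) ∘ ⊕_{s,t}⁻¹` on closed subsets of `[0,s+t] × L`. -/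
def concatLaw (μ : ∀ t : PosReal, Measure (ClosedSets L t)) (s t : PosReal) :
    Measure (ClosedSets L (s + t)) :=
  ((μ s).prod (μ t)).map (concat s t)

/-- Factorizing families of probability measures over `[0,1] × L`. -/
structure IsFactorizingFamily (μ : ∀ t : PosReal, Measure (ClosedSets L t)) : Prop where
  isProbabilityMeasure : ∀ t, IsProbabilityMeasure (μ t)
  factorization : ∀ s t, MeasEquiv (μ (s + t)) (concatLaw μ s t)
  no_time_slices : ∀ (t : PosReal), ∀ r ∈ Set.Icc (0 : ℝ) (t : ℝ),
    μ t {Z | (Z.carrier ∩ ({r} ×ˢ Set.univ)).Nonempty} = 0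

/-- Measurable factorizing families over `[0,1] × L`. -/
structure IsMeasurableFactorizingFamily (μ : ∀ t : PosReal, Measure (ClosedSets L t)) : Prop
    extends IsFactorizingFamily μ where
  /-- `μ_t` is not supported on finitely many atoms. -/
  nondegenerate : ∀ (t : PosReal) (F : Set (ClosedSets L t)), F.Finite → μ t Fᶜ ≠ 0
  /-- Measurability of `t ↦ (σ_t)_* μ_t` on a countable generating ring of sets. -/
  measurable_laws : ∃ R : Set (Set (ClosedSets L 1)), R.Countable ∧ IsSetRing R ∧
    MeasurableSpace.generateFrom R = (inferInstance : MeasurableSpace (ClosedSets L 1)) ∧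
    ∀ A ∈ R, Measurable fun t : PosReal => (μ t).map (rescale t 1) A
  /-- The derivatives `d((μ_s ⊗ μ_t) ∘ ⊕⁻¹)/dμ_{s+t}` have a strictly positive, finite version that
  is jointly Borel in `(s, t)` and the rescaled set. -/
  measurable_derivatives : ∃ Δ : (PosReal × PosReal) × ClosedSets L 1 → PosReal, Measurable Δ ∧
    ∀ s t : PosReal, ∀ᵐ Z ∂(μ (s + t)),
      ENNReal.ofReal (Δ ((s, t), rescale (s + t) 1 Z) : ℝ) =
        (concatLaw μ s t).rnDeriv (μ (s + t)) Z

/-- The Hellinger integral between `μ_{s+t}` and `(μ_s ⊗ μ_t) ∘ ⊕_{s,t}⁻¹`. -/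
def hellinger (μ : ∀ t : PosReal, Measure (ClosedSets L t)) (s t : PosReal) : ℝ :=
  ∫ Z, Real.sqrt ((μ (s + t)).rnDeriv (concatLaw μ s t) Z).toReal ∂(concatLaw μ s t)

/-- For all `s, t > 0`, `1 - H_{λs,λt} ≤ C_{s,t} λ²` for all sufficiently small `λ > 0`. -/
def HellingerSmall (μ : ∀ t : PosReal, Measure (ClosedSets L t)) : Prop :=
  ∀ s t : PosReal, ∃ C : ℝ, ∃ ε : PosReal, ∀ l : PosReal, l < ε →
    1 - hellinger μ (l * s) (l * t) ≤ C * (l : ℝ) ^ 2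

end Families

/-- The image of `ν_{bt}` under the dilation `Z ↦ {(u/b, *) : (u, *) ∈ Z}` from `[0,bt]`
to `[0,t]`. -/
def dilatedCopy (ν : ∀ t : PosReal, Measure (ClosedSets Unit t)) (b : PosReal) (t : PosReal) :
    Measure (ClosedSets Unit t) :=
  (ν (b * t)).map (rescale (b * t) t)

/-- The marked infinite product: the law of `⋃ₙ Zₙ × {n}`, where `(Zₙ)ₙ` is distributed according
to the infinite product measure of the dilated copies of `ν` with factors `a n`. -/
def markedProduct (ν : ∀ t : PosReal, Measure (ClosedSets Unit t)) (a : ℕ → PosReal)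
    (t : PosReal) : Measure (ClosedSets ℕ t) :=
  (Measure.infinitePi fun n => dilatedCopy ν (a n) t).map (assemble t)

end

/-! Concatenation acts on each mark separately. Hence `μ_{s+t}` and the law of the concatenation are
images, under the same map `assemble`, of two infinite products over the marks: one with factors the
dilated copies of `ν_{a_n(s+t)}`, the other with factors their concatenation laws
(`concatLaw_markedProduct`). Corresponding factors are equivalent because `ν` factorizes. A dilation
is an isomorphism of measurable spaces, so the Hellinger affinity of the `n`-th pair is `H_{a_n s,
a_n t}`. Hellinger-smallness with `λ = a_n` bounds its defect from `1` by `C a_n²` for large `n`,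
which is summable, and Kakutani's theorem (`measEquiv_infinitePi`) gives equivalence of the products
and of their images.

Null time slices and nondegeneracy reduce to single marks. For the measurability axioms, the laws
transported to `[0,1]` depend measurably on `t`, since box probabilities are finite products of
measurable functions. The Fell σ-field is countably generated, so Radon-Nikodym derivatives of
kernels supply jointly measurable densities (`exists_measurable_derivatives`). -/

/-! ### Hellinger affinities and Kakutani's theorem. -/

section Kakutani

open Filter Topology

/-- The Hellinger affinity `∫ √(dμ/dν) dν`. -/
noncomputable def hellingerAffinity {X : Type*} [MeasurableSpace X] (μ ν : Measure X) : ℝ :=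
  ∫ x, Real.sqrt (μ.rnDeriv ν x).toReal ∂ν

section Affinity

variable {X : Type*} [MeasurableSpace X] {μ ν : Measure X}

lemma measurable_sqrt_rnDeriv (μ ν : Measure X) :
    Measurable fun x => Real.sqrt (μ.rnDeriv ν x).toReal :=
  (Measure.measurable_rnDeriv μ ν).ennreal_toReal.sqrt

lemma integrable_sqrt_rnDeriv [IsProbabilityMeasure μ] [IsProbabilityMeasure ν] :
    Integrable (fun x => Real.sqrt (μ.rnDeriv ν x).toReal) ν := by
  refine ((integrable_const (1 : ℝ)).add
    (Measure.integrable_toReal_rnDeriv (μ := μ) (ν := ν))).mono'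
    (measurable_sqrt_rnDeriv μ ν).aestronglyMeasurable (ae_of_all _ fun x => ?_)
  have h0 : (0 : ℝ) ≤ (μ.rnDeriv ν x).toReal := ENNReal.toReal_nonneg
  have h := Real.sq_sqrt h0
  rw [Real.norm_of_nonneg (Real.sqrt_nonneg _)]
  simp only [Pi.add_apply]
  nlinarith [sq_nonneg (Real.sqrt (μ.rnDeriv ν x).toReal - 1),
    Real.sqrt_nonneg (μ.rnDeriv ν x).toReal]

lemma hellingerAffinity_nonneg (μ ν : Measure X) : 0 ≤ hellingerAffinity μ ν :=
  integral_nonneg fun _ => Real.sqrt_nonneg _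

/-- Integrate `√x ≤ (1 + x) / 2`; absolute continuity makes the density integrate to `1`. -/
lemma hellingerAffinity_le_one [IsProbabilityMeasure μ] [IsProbabilityMeasure ν] (h : μ ≪ ν) :
    hellingerAffinity μ ν ≤ 1 := by
  have h1 : hellingerAffinity μ ν ≤ ∫ x, (1 / 2 + (μ.rnDeriv ν x).toReal / 2) ∂ν := by
    refine integral_mono integrable_sqrt_rnDeriv
      ((integrable_const _).add (Measure.integrable_toReal_rnDeriv.div_const 2)) fun x => ?_
    have h0 : (0 : ℝ) ≤ (μ.rnDeriv ν x).toReal := ENNReal.toReal_nonneg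
    have h := Real.sq_sqrt h0
    simp only
    nlinarith [sq_nonneg (Real.sqrt (μ.rnDeriv ν x).toReal - 1)]
  rw [integral_add (integrable_const _) (Measure.integrable_toReal_rnDeriv.div_const 2),
    integral_div _ fun x => (μ.rnDeriv ν x).toReal, Measure.integral_toReal_rnDeriv h] at h1
  simp only [integral_const, probReal_univ, smul_eq_mul] at h1
  linarith

lemma hellingerAffinity_comm [SigmaFinite μ] [SigmaFinite ν] (h : μ ≪ ν) (h' : ν ≪ μ) :
    hellingerAffinity μ ν = hellingerAffinity ν μ := by
  unfold hellingerAffinity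
  rw [← integral_toReal_rnDeriv_mul (μ := μ) (ν := ν) h]
  refine integral_congr_ae ?_
  filter_upwards [Measure.inv_rnDeriv h'] with x hx
  rw [← hx, Pi.inv_apply, ENNReal.toReal_inv, Real.sqrt_inv, ← Real.sqrt_div_self, div_eq_inv_mul]

lemma hellingerAffinity_map_equiv {Y : Type*} [MeasurableSpace Y] [SigmaFinite μ] [SigmaFinite ν]
    (e : X ≃ᵐ Y) : hellingerAffinity (μ.map e) (ν.map e) = hellingerAffinity μ ν := by
  unfold hellingerAffinity
  rw [integral_map_equiv]
  refine integral_congr_ae ?_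
  filter_upwards [e.measurableEmbedding.rnDeriv_map μ ν] with x hx
  rw [hx]

end Affinity

lemma one_sub_sum_le_prod {ι : Type*} (s : Finset ι) (h : ι → ℝ) (h0 : ∀ i, 0 ≤ h i)
    (h1 : ∀ i, h i ≤ 1) : 1 - ∑ i ∈ s, (1 - h i) ≤ ∏ i ∈ s, h i := by
  classical
  induction s using Finset.induction_on with
  | empty => simp
  | insert i s hi ih =>
    rw [Finset.sum_insert hi, Finset.prod_insert hi]
    have hp : ∏ i ∈ s, h i ≤ 1 := Finset.prod_le_one (fun i _ => h0 i) fun i _ => h1 i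
    nlinarith [h0 i, h1 i]

variable {X : ℕ → Type*} [∀ n, MeasurableSpace (X n)] {μ ν : ∀ n, Measure (X n)}

/-- The square root of the density of the product of the first `M` factors. -/
noncomputable def sqrtDensityProd (μ ν : ∀ n, Measure (X n)) (M : ℕ) (x : ∀ n, X n) : ℝ :=
  ∏ n ∈ Finset.range M, Real.sqrt ((μ n).rnDeriv (ν n) (x n)).toReal

/-- Below `M` the two square roots multiply to the full density, which has integral `1`; between `M`
and `K` only one root remains. The inner product in `L²` is therefore the product of the affinities
over `[M, K)`. -/
lemma sqrtDensityProd_mul_eq {M K : ℕ} (hMK : M ≤ K) (x : ∀ n, X n) :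
    sqrtDensityProd μ ν M x * sqrtDensityProd μ ν K x =
      ∏ n ∈ Finset.range K, (fun n y => if n < M then ((μ n).rnDeriv (ν n) y).toReal
        else Real.sqrt ((μ n).rnDeriv (ν n) y).toReal) n (x n) := by
  unfold sqrtDensityProd
  rw [← Finset.prod_range_mul_prod_Ico _ hMK, ← mul_assoc, ← Finset.prod_mul_distrib,
    ← Finset.prod_range_mul_prod_Ico _ hMK]
  refine congr_arg₂ (· * ·) (Finset.prod_congr rfl fun n hn => ?_)
    (Finset.prod_congr rfl fun n hn => ?_)
  · simp only [if_pos (Finset.mem_range.1 hn)]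
    exact Real.mul_self_sqrt ENNReal.toReal_nonneg
  · simp only [if_neg (Finset.mem_Ico.1 hn).1.not_gt]

lemma sqrtDensityProd_nonneg (M : ℕ) (x : ∀ n, X n) : 0 ≤ sqrtDensityProd μ ν M x :=
  Finset.prod_nonneg fun _ _ => Real.sqrt_nonneg _

variable [∀ n, IsProbabilityMeasure (μ n)] [∀ n, IsProbabilityMeasure (ν n)]

lemma integrable_prod_infinitePi (s : Finset ℕ) {f : ∀ n, X n → ℝ}
    (hf : ∀ n, Integrable (f n) (ν n)) :
    Integrable (fun x : ∀ n, X n => ∏ n ∈ s, f n (x n)) (Measure.infinitePi ν) := by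
  have h := Integrable.fintype_prod_dep (f := fun n : s => f n) (μ := fun n : s => ν n)
    fun n => hf n
  have hp : MeasurePreserving s.restrict (Measure.infinitePi ν) (Measure.pi fun n : s => ν n) :=
    ⟨Finset.measurable_restrict s, Measure.infinitePi_map_restrict ν⟩
  refine (hp.integrable_comp_of_integrable h).congr (ae_of_all _ fun x => ?_)
  exact Finset.prod_coe_sort s fun n => f n (x n)

lemma integral_prod_infinitePi (s : Finset ℕ) {f : ∀ n, X n → ℝ}
    (hf : ∀ n, Integrable (f n) (ν n)) :
    ∫ x, ∏ n ∈ s, f n (x n) ∂Measure.infinitePi ν = ∏ n ∈ s, ∫ y, f n y ∂ν n := by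
  have h := Integrable.fintype_prod_dep (f := fun n : s => f n) (μ := fun n : s => ν n)
    fun n => hf n
  have h2 := integral_restrict_infinitePi ν h.aestronglyMeasurable
  rw [integral_fintype_prod_eq_prod] at h2
  rw [← Finset.prod_coe_sort, ← h2]
  refine integral_congr_ae (ae_of_all _ fun x => ?_)
  exact (Finset.prod_coe_sort s fun n => f n (x n)).symm

lemma integrable_ite_rnDeriv (M n : ℕ) :
    Integrable ((fun (n : ℕ) (y : X n) => if n < M then ((μ n).rnDeriv (ν n) y).toReal
        else Real.sqrt ((μ n).rnDeriv (ν n) y).toReal) n) (ν n) := by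
  by_cases h : n < M
  · simpa only [if_pos h] using Measure.integrable_toReal_rnDeriv
  · simpa only [if_neg h] using integrable_sqrt_rnDeriv

lemma integrable_sqrtDensityProd_mul {M K : ℕ} (hMK : M ≤ K) :
    Integrable (fun x => sqrtDensityProd μ ν M x * sqrtDensityProd μ ν K x)
      (Measure.infinitePi ν) := by
  simp_rw [sqrtDensityProd_mul_eq hMK]
  exact integrable_prod_infinitePi _ (integrable_ite_rnDeriv M)

lemma integral_sqrtDensityProd_mul (hμν : ∀ n, μ n ≪ ν n) {M K : ℕ} (hMK : M ≤ K) :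
    ∫ x, sqrtDensityProd μ ν M x * sqrtDensityProd μ ν K x ∂Measure.infinitePi ν =
      ∏ n ∈ Finset.Ico M K, hellingerAffinity (μ n) (ν n) := by
  simp_rw [sqrtDensityProd_mul_eq hMK]
  rw [integral_prod_infinitePi _ (integrable_ite_rnDeriv M),
    ← Finset.prod_range_mul_prod_Ico _ hMK, Finset.prod_eq_one fun n hn => ?_, one_mul]
  · refine Finset.prod_congr rfl fun n hn => ?_
    simp only [if_neg (Finset.mem_Ico.1 hn).1.not_gt]
    rfl
  · simp only [if_pos (Finset.mem_range.1 hn)]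
    rw [Measure.integral_toReal_rnDeriv (hμν n), probReal_univ]

lemma integrable_sqrtDensityProd_sq (M : ℕ) :
    Integrable (fun x => sqrtDensityProd μ ν M x ^ 2) (Measure.infinitePi ν) := by
  simpa only [sq] using integrable_sqrtDensityProd_mul (μ := μ) (ν := ν) (le_refl M)

/-- With `g`, `k` the two root densities, `|g² - k²| = |g - k| (g + k)` is at most `|g - k|² / (2δ)
+ δ (g + k)² / 2`. As `∫ g² = ∫ k² = 1` and `∫ g k = P`, this integrates to `(1 - P) / δ + δ (1 +
P)`. The free parameter `δ` replaces Cauchy-Schwarz. -/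
lemma integral_abs_sub_le (hμν : ∀ n, μ n ≪ ν n) {M K : ℕ} (hMK : M ≤ K) {δ : ℝ} (hδ : 0 < δ) :
    ∫ x, |sqrtDensityProd μ ν M x ^ 2 - sqrtDensityProd μ ν K x ^ 2| ∂Measure.infinitePi ν ≤
      (∑ n ∈ Finset.Ico M K, (1 - hellingerAffinity (μ n) (ν n))) / δ + 2 * δ := by
  set G := sqrtDensityProd μ ν
  set P := ∏ n ∈ Finset.Ico M K, hellingerAffinity (μ n) (ν n) with hP
  have hM : Integrable (fun x => G M x ^ 2) _ :=
    integrable_sqrtDensityProd_sq (μ := μ) (ν := ν) M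
  have hK : Integrable (fun x => G K x ^ 2) _ :=
    integrable_sqrtDensityProd_sq (μ := μ) (ν := ν) K
  have hX : Integrable (fun x => G M x * G K x) _ :=
    integrable_sqrtDensityProd_mul (μ := μ) (ν := ν) hMK
  have hS : Integrable (fun x => (1 / (2 * δ) + δ / 2) * (G M x ^ 2 + G K x ^ 2)) _ :=
    (hM.add hK).const_mul _
  have iM : ∫ x, G M x ^ 2 ∂Measure.infinitePi ν = 1 := by
    simpa [sq] using integral_sqrtDensityProd_mul hμν (le_refl M)
  have iK : ∫ x, G K x ^ 2 ∂Measure.infinitePi ν = 1 := by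
    simpa [sq] using integral_sqrtDensityProd_mul hμν (le_refl K)
  have iX : ∫ x, G M x * G K x ∂Measure.infinitePi ν = P := integral_sqrtDensityProd_mul hμν hMK
  have hP1 : P ≤ 1 := Finset.prod_le_one (fun n _ => hellingerAffinity_nonneg _ _)
    fun n _ => hellingerAffinity_le_one (hμν n)
  have hP0 : 1 - P ≤ ∑ n ∈ Finset.Ico M K, (1 - hellingerAffinity (μ n) (ν n)) := by
    have := one_sub_sum_le_prod (Finset.Ico M K) (fun n => hellingerAffinity (μ n) (ν n))
      (fun n => hellingerAffinity_nonneg _ _) fun n => hellingerAffinity_le_one (hμν n)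
    linarith
  have hle : ∫ x, |G M x ^ 2 - G K x ^ 2| ∂Measure.infinitePi ν ≤
      ∫ x, ((1 / (2 * δ) + δ / 2) * (G M x ^ 2 + G K x ^ 2) -
        (1 / δ - δ) * (G M x * G K x)) ∂Measure.infinitePi ν := by
    refine integral_mono (hM.sub hK).abs
      (hS.sub (hX.const_mul _)) fun x => ?_
    have h1 : |G M x ^ 2 - G K x ^ 2| = |G M x - G K x| * (G M x + G K x) := by
      rw [sq_sub_sq, abs_mul, abs_of_nonneg (add_nonneg (sqrtDensityProd_nonneg M x)
        (sqrtDensityProd_nonneg K x)), mul_comm]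
    have h2 : (1 / (2 * δ) + δ / 2) * (G M x ^ 2 + G K x ^ 2) -
        (1 / δ - δ) * (G M x * G K x) =
        (|G M x - G K x| ^ 2 + (δ * (G M x + G K x)) ^ 2) / (2 * δ) := by
      rw [sq_abs]
      field_simp
      ring
    simp only
    rw [h1, h2, le_div_iff₀ (by positivity)]
    nlinarith [sq_nonneg (|G M x - G K x| - δ * (G M x + G K x))]
  rw [integral_sub hS (hX.const_mul _), integral_const_mul,
    integral_const_mul, integral_add hM hK, iM, iK, iX] at hle
  refine hle.trans ?_
  have : (1 / (2 * δ) + δ / 2) * (1 + 1) - (1 / δ - δ) * P = (1 - P) / δ + δ * (1 + P) := by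
    field_simp
    ring
  rw [this]
  have h3 := (div_le_div_iff_of_pos_right hδ).2 hP0
  nlinarith

/-- Factors outside `s` integrate to `1`, so the value no longer depends on `M` once the first `M`
coordinates include `s`. -/
lemma setIntegral_sqrtDensityProd_sq (hμν : ∀ n, μ n ≪ ν n) (s : Finset ℕ)
    {t : ∀ n, Set (X n)} (ht : ∀ n, MeasurableSet (t n)) {M : ℕ} (hM : s ⊆ Finset.range M) :
    ∫ x in Set.pi s t, sqrtDensityProd μ ν M x ^ 2 ∂Measure.infinitePi ν =
      ∏ n ∈ s, (μ n).real (t n) := by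
  classical
  have hs : MeasurableSet (Set.pi (s : Set ℕ) t) :=
    MeasurableSet.pi s.countable_toSet fun n _ => ht n
  let f : ∀ n, X n → ℝ := fun n => (if n ∈ s then t n else Set.univ).indicator
    fun y => ((μ n).rnDeriv (ν n) y).toReal
  have hmeas : ∀ n, MeasurableSet (if n ∈ s then t n else Set.univ) := fun n => by
    split_ifs
    exacts [ht n, .univ]
  have hf : ∀ n, Integrable (f n) (ν n) := fun n =>
    Measure.integrable_toReal_rnDeriv.indicator (hmeas n)
  rw [← integral_indicator hs]
  have h1 : ∀ x, (Set.pi (s : Set ℕ) t).indicator (fun x => sqrtDensityProd μ ν M x ^ 2) x =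
      ∏ n ∈ Finset.range M, f n (x n) := by
    intro x
    by_cases hx : x ∈ Set.pi (s : Set ℕ) t
    · rw [Set.indicator_of_mem hx, sqrtDensityProd, ← Finset.prod_pow]
      refine Finset.prod_congr rfl fun n _ => ?_
      rw [Real.sq_sqrt ENNReal.toReal_nonneg]
      have hxn : x n ∈ if n ∈ s then t n else Set.univ := by
        split_ifs with h
        exacts [hx n h, trivial]
      exact (Set.indicator_of_mem hxn fun y => ((μ n).rnDeriv (ν n) y).toReal).symm
    · rw [Set.indicator_of_notMem hx]
      simp only [Set.mem_pi, not_forall] at hx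
      obtain ⟨n, hn, hxn⟩ := hx
      have h0 : f n (x n) = 0 := by
        have hxn' : x n ∉ if n ∈ s then t n else Set.univ := by
          rwa [if_pos (by simpa using hn)]
        exact Set.indicator_of_notMem hxn' _
      exact (Finset.prod_eq_zero (hM hn) h0).symm
  simp_rw [h1]
  rw [integral_prod_infinitePi _ hf, ← Finset.prod_subset hM]
  · refine Finset.prod_congr rfl fun n hn => ?_
    rw [integral_indicator (hmeas n), if_pos hn, Measure.setIntegral_toReal_rnDeriv (hμν n)]
  · intro n _ hn
    rw [integral_indicator (hmeas n), if_neg hn, Measure.setIntegral_toReal_rnDeriv (hμν n),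
      probReal_univ]

/-- The absolute continuity half of Kakutani's theorem on infinite product measures. -/
theorem infinitePi_absolutelyContinuous (hμν : ∀ n, μ n ≪ ν n)
    (hsum : Summable fun n => 1 - hellingerAffinity (μ n) (ν n)) :
    Measure.infinitePi μ ≪ Measure.infinitePi ν := by
  set φ : ℕ → (∀ n, X n) →₁[Measure.infinitePi ν] ℝ := fun M =>
    (integrable_sqrtDensityProd_sq (μ := μ) (ν := ν) M).toL1 _ with hφ
  have hcauchy : CauchySeq φ := by
    rw [Metric.cauchySeq_iff']
    intro ε hε
    -- With `δ = ε / 4` and a tail sum below `δ²`, the bound of `integral_abs_sub_le` is below `δ +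
    -- 2δ < ε`.
    have hδ : 0 < ε / 4 := by positivity
    obtain ⟨M, hM⟩ := ((hsum.hasSum.tendsto_sum_nat).eventually
      (lt_mem_nhds (sub_lt_self _ (pow_pos hδ 2)))).exists
    refine ⟨M, fun K hK => ?_⟩
    have hd : dist (φ K) (φ M) =
        ∫ x, |sqrtDensityProd μ ν M x ^ 2 - sqrtDensityProd μ ν K x ^ 2| ∂Measure.infinitePi ν := by
      rw [dist_comm, dist_eq_norm, hφ]
      simp only
      rw [← Integrable.toL1_sub, L1.norm_eq_integral_norm]
      refine integral_congr_ae ?_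
      filter_upwards [Integrable.coeFn_toL1 ((integrable_sqrtDensityProd_sq (μ := μ) (ν := ν)
        M).sub (integrable_sqrtDensityProd_sq (μ := μ) (ν := ν) K))] with x hx
      rw [hx, Real.norm_eq_abs]
      rfl
    rw [hd]
    refine (integral_abs_sub_le hμν hK hδ).trans_lt ?_
    have hle := hsum.sum_le_tsum (Finset.range K)
      fun n _ => sub_nonneg.2 (hellingerAffinity_le_one (hμν n))
    rw [← Finset.sum_range_add_sum_Ico _ hK] at hle
    have : (∑ n ∈ Finset.Ico M K, (1 - hellingerAffinity (μ n) (ν n))) / (ε / 4) < ε / 4 := by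
      rw [div_lt_iff₀ hδ]
      nlinarith
    linarith
  obtain ⟨F, hF⟩ := cauchySeq_tendsto_of_complete hcauchy
  have hF0 : 0 ≤ᵐ[Measure.infinitePi ν] F := by
    rw [Lp.coeFn_nonneg]
    refine ge_of_tendsto' hF fun M => ?_
    rw [← Lp.coeFn_nonneg]
    filter_upwards [Integrable.coeFn_toL1 (integrable_sqrtDensityProd_sq (μ := μ) (ν := ν)
      M)] with x hx
    rw [hx]
    exact sq_nonneg _
  have hFi := L1.integrable_coeFn F
  -- Integration over a box is continuous on `L¹`, and along the partial products it is eventually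
  -- constant. So the limit density `F` gives each box its mass under the product of the `μ n`,
  -- which determines the measure.
  have hP : (Measure.infinitePi ν).withDensity (fun x => ENNReal.ofReal (F x)) =
      Measure.infinitePi μ := by
    refine Measure.eq_infinitePi μ fun s t ht => ?_
    have hs : MeasurableSet (Set.pi (s : Set ℕ) t) :=
      MeasurableSet.pi s.countable_toSet fun n _ => ht n
    have hlim := ((continuous_setIntegral (Set.pi (s : Set ℕ) t)).tendsto F).comp hF
    have hconst : ∀ᶠ M in atTop, ∫ x in Set.pi (s : Set ℕ) t, φ M x ∂Measure.infinitePi ν =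
        ∏ n ∈ s, (μ n).real (t n) := by
      obtain ⟨M₀, hM₀⟩ := s.exists_nat_subset_range
      filter_upwards [eventually_ge_atTop M₀] with M hM
      rw [← setIntegral_sqrtDensityProd_sq hμν s ht
        (hM₀.trans (Finset.range_subset_range.2 hM))]
      exact integral_congr_ae (ae_restrict_of_ae (Integrable.coeFn_toL1 _))
    have hval : ∫ x in Set.pi (s : Set ℕ) t, F x ∂Measure.infinitePi ν =
        ∏ n ∈ s, (μ n).real (t n) :=
      tendsto_nhds_unique hlim (tendsto_const_nhds.congr' (hconst.mono fun M h => h.symm))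
    rw [withDensity_apply _ hs, ← ofReal_integral_eq_lintegral_ofReal hFi.integrableOn
      (ae_restrict_of_ae hF0), hval, ENNReal.ofReal_prod_of_nonneg fun n _ => measureReal_nonneg]
    exact Finset.prod_congr rfl fun n _ => ofReal_measureReal
  rw [← hP]
  exact withDensity_absolutelyContinuous _ _

/-- Kakutani's theorem: two infinite product measures with equivalent factors are equivalent if
the Hellinger affinities of the factors are summably close to `1`. -/
theorem measEquiv_infinitePi (h : ∀ n, MeasEquiv (μ n) (ν n))
    (hsum : Summable fun n => 1 - hellingerAffinity (μ n) (ν n)) :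
    MeasEquiv (Measure.infinitePi μ) (Measure.infinitePi ν) := by
  refine ⟨infinitePi_absolutelyContinuous (fun n => (h n).1) hsum,
    infinitePi_absolutelyContinuous (fun n => (h n).2) ?_⟩
  simpa only [hellingerAffinity_comm (h _).2 (h _).1] using hsum

end Kakutani

/-! ### The Fell topology and measurability of the set operations. -/

section Fell

open ClosedSets Topology TopologicalSpace

variable {L : Type*} [TopologicalSpace L]

lemma isOpen_hit (t : PosReal) {O : Set (ℝ × L)} (hO : IsOpen O) :
    IsOpen {F : ClosedSets L t | (F.carrier ∩ O).Nonempty} :=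
  isOpen_generateFrom_of_mem (Or.inl ⟨O, hO, rfl⟩)

lemma isOpen_miss (t : PosReal) {K : Set (ℝ × L)} (hK : IsCompact K) :
    IsOpen {F : ClosedSets L t | F.carrier ∩ K = ∅} :=
  isOpen_generateFrom_of_mem (Or.inr ⟨K, hK, rfl⟩)

lemma measurableSet_hit (t : PosReal) {O : Set (ℝ × L)} (hO : IsOpen O) :
    MeasurableSet {F : ClosedSets L t | (F.carrier ∩ O).Nonempty} :=
  (isOpen_hit t hO).measurableSet

lemma measurableSet_mem_carrier (t : PosReal) (x : ℝ × L) :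
    MeasurableSet {F : ClosedSets L t | x ∈ F.carrier} := by
  simpa [Set.compl_ofPred] using (isOpen_miss t (isCompact_singleton (x := x))).measurableSet.compl

/-- A closed set differs from `Z` iff it hits the complement of `Z` or misses a point of `Z`. This
makes finite families of closed sets measurable. -/
instance instT1SpaceClosedSets (t : PosReal) : T1Space (ClosedSets L t) := by
  refine ⟨fun Z => ?_⟩
  rw [← isOpen_compl_iff]
  have h : ({Z}ᶜ : Set (ClosedSets L t)) = {F | (F.carrier ∩ Z.carrierᶜ).Nonempty} ∪
      ⋃ x ∈ Z.carrier, {F | F.carrier ∩ {x} = ∅} := by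
    ext F
    simp only [Set.mem_compl_iff, Set.mem_singleton_iff, Set.mem_union, Set.mem_ofPred_eq,
      Set.mem_iUnion, Set.inter_singleton_eq_empty, Set.inter_compl_nonempty_iff, exists_prop]
    rw [ClosedSets.ext_iff, Set.Subset.antisymm_iff, not_and_or, Set.not_subset (s := Z.carrier)]
  rw [h]
  exact (isOpen_hit t Z.isClosed'.isOpen_compl).union
    (isOpen_biUnion fun x _ => isOpen_miss t isCompact_singleton)

section Countable

variable [SecondCountableTopology L]

/-- An open `W` is a countable union of basic rectangles, so hitting a section that varies with a
parameter is a jointly measurable event. -/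
lemma measurableSet_hit_family {P : Type*} [TopologicalSpace P] [SecondCountableTopology P]
    [MeasurableSpace P] [OpensMeasurableSpace P] (t : PosReal) {W : Set (P × (ℝ × L))}
    (hW : IsOpen W) : MeasurableSet {q : P × ClosedSets L t | ∃ z ∈ q.2.carrier, (q.1, z) ∈ W} := by
  have hb := isBasis_countableBasis (ℝ × L)
  have hbP := isBasis_countableBasis P
  have h : {q : P × ClosedSets L t | ∃ z ∈ q.2.carrier, (q.1, z) ∈ W} =
      ⋃ U ∈ countableBasis P, ⋃ V ∈ {V ∈ countableBasis (ℝ × L) | U ×ˢ V ⊆ W},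
        U ×ˢ {F : ClosedSets L t | (F.carrier ∩ V).Nonempty} := by
    ext ⟨p, F⟩
    simp only [Set.mem_iUnion, Set.mem_ofPred_eq, exists_prop, Set.mem_prod]
    constructor
    · rintro ⟨z, hz, hzW⟩
      obtain ⟨_, ⟨U, hU, V, hV, rfl⟩, hmem, hsub⟩ :=
        (hbP.prod hb).exists_subset_of_mem_open hzW hW
      exact ⟨U, hU, V, ⟨hV, hsub⟩, hmem.1, z, hz, hmem.2⟩
    · rintro ⟨U, hU, V, ⟨hV, hsub⟩, hp, z, hz, hzV⟩
      exact ⟨z, hz, hsub ⟨hp, hzV⟩⟩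
  rw [h]
  refine MeasurableSet.biUnion (countable_countableBasis P) fun U hU =>
    MeasurableSet.biUnion ((countable_countableBasis _).mono (Set.sep_subset _ _)) fun V hV => ?_
  exact (hbP.isOpen hU).measurableSet.prod (measurableSet_hit t (hb.isOpen hV.1))

variable [LocallyCompactSpace L] [T2Space L]

/-- Finite unions of basic open sets suffice: cover `K` by basic sets inside a compact neighbourhood
contained in `U`. -/
lemma exists_countable_compact_between : ∃ C : Set (Set (ℝ × L)), C.Countable ∧
    ∀ K U : Set (ℝ × L), IsCompact K → IsOpen U → K ⊆ U →
      ∃ V ∈ C, IsOpen V ∧ IsCompact (closure V) ∧ K ⊆ V ∧ closure V ⊆ U := by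
  refine ⟨Set.sUnion '' {A : Set (Set (ℝ × L)) | A.Finite ∧ A ⊆ countableBasis (ℝ × L)},
    (Set.countable_ofPred_finite_subset (countable_countableBasis (ℝ × L))).image _,
    fun K U hK hU hKU => ?_⟩
  obtain ⟨M, hM, hKM, hMU⟩ := exists_compact_between hK hU hKU
  have hb := isBasis_countableBasis (ℝ × L)
  obtain ⟨A, hA, hAf, hKA⟩ := hK.elim_finite_subcover_image
    (b := {B ∈ countableBasis (ℝ × L) | B ⊆ interior M}) (c := id) (fun B hB => hb.isOpen hB.1)
    (by
      intro x hx
      obtain ⟨B, hB, hxB, hBM⟩ := hb.exists_subset_of_mem_open (hKM hx) isOpen_interior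
      exact Set.mem_biUnion ⟨hB, hBM⟩ hxB)
  have hAM : ⋃₀ A ⊆ M := Set.sUnion_subset fun B hB => (hA hB).2.trans interior_subset
  have hcl : closure (⋃₀ A) ⊆ M := closure_minimal hAM hM.isClosed
  refine ⟨⋃₀ A, ⟨A, ⟨hAf, fun B hB => (hA hB).1⟩, rfl⟩,
    isOpen_sUnion fun B hB => hb.isOpen (hA hB).1, hM.of_isClosed_subset isClosed_closure hcl,
    ?_, hcl.trans hMU⟩
  rwa [Set.sUnion_eq_biUnion]

/-- Hitting `O` means hitting a basic open subset of `O`. Missing `K` means missing one of countably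
many compact neighbourhoods of `K`, since a closed set disjoint from `K` stays away from such a
neighbourhood. -/
instance instSecondCountableTopologyClosedSets (t : PosReal) :
    SecondCountableTopology (ClosedSets L t) := by
  obtain ⟨C, hC, hC'⟩ := exists_countable_compact_between (L := L)
  have hb := isBasis_countableBasis (ℝ × L)
  refine ⟨(fun B => {F : ClosedSets L t | (F.carrier ∩ B).Nonempty}) '' countableBasis (ℝ × L) ∪
    (fun V => {F : ClosedSets L t | F.carrier ∩ closure V = ∅}) ''
      {V ∈ C | IsCompact (closure V)},
    ((countable_countableBasis _).image _).union ((hC.mono (Set.sep_subset _ _)).image _),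
    le_antisymm (le_generateFrom ?_) (le_generateFrom ?_)⟩
  · rintro _ (⟨B, hB, rfl⟩ | ⟨V, hV, rfl⟩)
    exacts [isOpen_hit t (hb.isOpen hB), isOpen_miss t hV.2]
  · rintro _ (⟨O, hO, rfl⟩ | ⟨K, hK, rfl⟩)
    · have h : {F : ClosedSets L t | (F.carrier ∩ O).Nonempty} =
          ⋃ B ∈ {B ∈ countableBasis (ℝ × L) | B ⊆ O}, {F | (F.carrier ∩ B).Nonempty} := by
        ext F
        simp only [Set.mem_iUnion, Set.mem_ofPred_eq, exists_prop]
        refine ⟨fun ⟨x, hxF, hxO⟩ => ?_, fun ⟨B, hB, x, hxF, hxB⟩ => ⟨x, hxF, hB.2 hxB⟩⟩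
        obtain ⟨B, hB, hxB, hBO⟩ := hb.exists_subset_of_mem_open hxO hO
        exact ⟨B, ⟨hB, hBO⟩, x, hxF, hxB⟩
      rw [h]
      exact @isOpen_biUnion _ _ (generateFrom _) _ _
        fun B hB => isOpen_generateFrom_of_mem (Or.inl ⟨B, hB.1, rfl⟩)
    · have h : {F : ClosedSets L t | F.carrier ∩ K = ∅} =
          ⋃ V ∈ {V ∈ C | IsCompact (closure V) ∧ K ⊆ V}, {F | F.carrier ∩ closure V = ∅} := by
        ext F
        simp only [Set.mem_iUnion, Set.mem_ofPred_eq, exists_prop, ← Set.disjoint_iff_inter_eq_empty]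
        refine ⟨fun hF => ?_, fun ⟨V, hV, hF⟩ => hF.mono_right (hV.2.2.trans subset_closure)⟩
        obtain ⟨V, hV, -, hVc, hKV, hVF⟩ :=
          hC' K F.carrierᶜ hK F.isClosed'.isOpen_compl hF.subset_compl_left
        exact ⟨V, ⟨hV, hVc, hKV⟩, (Set.disjoint_left.2 fun x hx hx' => hVF hx' hx)⟩
      rw [h]
      exact @isOpen_biUnion _ _ (generateFrom _) _ _
        fun V hV => isOpen_generateFrom_of_mem (Or.inr ⟨V, ⟨hV.1, hV.2.1⟩, rfl⟩)

/-- Missing `K` is a countable union of complements of hit events, taken over the open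
neighbourhoods of `K` in the countable family. -/
lemma measurable_closedSets {α : Type*} [MeasurableSpace α] {t : PosReal}
    {f : α → ClosedSets L t}
    (hf : ∀ O : Set (ℝ × L), IsOpen O → MeasurableSet {a | ((f a).carrier ∩ O).Nonempty}) :
    Measurable f := by
  obtain ⟨C, hC, hC'⟩ := exists_countable_compact_between (L := L)
  have hgen : instMeasurableSpace (L := L) t = _ :=
    borel_eq_generateFrom_of_subbasis (t := instFellTopology (L := L) t) rfl
  rw [hgen]
  refine measurable_generateFrom ?_
  rintro _ (⟨O, hO, rfl⟩ | ⟨K, hK, rfl⟩)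
  · exact hf O hO
  · have h : f ⁻¹' {F : ClosedSets L t | F.carrier ∩ K = ∅} =
        ⋃ V ∈ {V ∈ C | IsOpen V ∧ K ⊆ V}, {a | ((f a).carrier ∩ V).Nonempty}ᶜ := by
      ext a
      simp only [Set.mem_iUnion, Set.mem_ofPred_eq, exists_prop, Set.mem_preimage,
        Set.mem_compl_iff, Set.not_nonempty_iff_eq_empty, ← Set.disjoint_iff_inter_eq_empty]
      refine ⟨fun hF => ?_, fun ⟨V, hV, hF⟩ => hF.mono_right hV.2.2⟩
      obtain ⟨V, hV, hVo, -, hKV, hVF⟩ :=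
        hC' K (f a).carrierᶜ hK (f a).isClosed'.isOpen_compl hF.subset_compl_left
      exact ⟨V, ⟨hV, hVo, hKV⟩,
        (Set.disjoint_left.2 fun x hx hx' => hVF (subset_closure hx') hx)⟩
    rw [h]
    exact MeasurableSet.biUnion (hC.mono (Set.sep_subset _ _)) fun V hV => (hf V hV.2.1).compl

lemma measurable_rescale (s t : PosReal) : Measurable (rescale (L := L) s t) := by
  refine measurable_closedSets fun O hO => ?_
  have hc : Continuous fun p : ℝ × L => ((t : ℝ) / (s : ℝ) * p.1, p.2) := by fun_prop
  have h := measurableSet_hit s (hO.preimage hc)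
  convert! h using 3 with Z
  exact Set.image_inter_nonempty_iff

lemma measurable_concat (s t : PosReal) : Measurable (concat (L := L) s t) := by
  refine measurable_closedSets fun O hO => ?_
  have hc : Continuous fun p : ℝ × L => ((s : ℝ) + p.1, p.2) := by fun_prop
  have h := (measurable_fst (measurableSet_hit s hO)).union
    (measurable_snd (measurableSet_hit t (hO.preimage hc)) :
      MeasurableSet (Prod.snd (α := ClosedSets L s) ⁻¹' _))
  convert! h using 1
  ext Z
  simp only [concat, Set.union_inter_distrib_right, Set.union_nonempty,
    Set.image_inter_nonempty_iff]
  rfl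

/-- The concatenation of the rescaled sets `s Z₁` and `t Z₂`, scaled back to `[0,1]`, depends
measurably on all data. -/
lemma measurable_rescale_concat_rescale :
    Measurable fun q : (PosReal × PosReal) × (ClosedSets L 1 × ClosedSets L 1) =>
      rescale (q.1.1 + q.1.2) 1
        (concat q.1.1 q.1.2 (rescale 1 q.1.1 q.2.1, rescale 1 q.1.2 q.2.2)) := by
  refine measurable_closedSets fun O hO => ?_
  have hne : ∀ q : (PosReal × PosReal) × (ℝ × L), (q.1.1 : ℝ) + (q.1.2 : ℝ) ≠ 0 :=
    fun q => (add_pos q.1.1.2 q.1.2.2).ne'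
  have hc₁ : Continuous fun q : (PosReal × PosReal) × (ℝ × L) =>
      (1 / ((q.1.1 : ℝ) + (q.1.2 : ℝ)) * ((q.1.1 : ℝ) / 1 * q.2.1), q.2.2) := by
    fun_prop (disch := exact hne _)
  have hc₂ : Continuous fun q : (PosReal × PosReal) × (ℝ × L) =>
      (1 / ((q.1.1 : ℝ) + (q.1.2 : ℝ)) * ((q.1.1 : ℝ) + (q.1.2 : ℝ) / 1 * q.2.1), q.2.2) := by
    fun_prop (disch := exact hne _)
  have m₁ : Measurable fun q : (PosReal × PosReal) × (ClosedSets L 1 × ClosedSets L 1) =>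
      (q.1, q.2.1) := by fun_prop
  have m₂ : Measurable fun q : (PosReal × PosReal) × (ClosedSets L 1 × ClosedSets L 1) =>
      (q.1, q.2.2) := by fun_prop
  have h := (m₁ (measurableSet_hit_family 1 (hO.preimage hc₁))).union
    (m₂ (measurableSet_hit_family 1 (hO.preimage hc₂)))
  convert! h using 1
  ext q
  constructor
  · rintro ⟨_, ⟨_, ⟨z, hz, rfl⟩ | ⟨_, ⟨z, hz, rfl⟩, rfl⟩, rfl⟩, hO⟩
    exacts [Or.inl ⟨z, hz, hO⟩, Or.inr ⟨z, hz, hO⟩]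
  · rintro (⟨z, hz, hO⟩ | ⟨z, hz, hO⟩)
    · exact ⟨_, ⟨_, Or.inl ⟨z, hz, rfl⟩, rfl⟩, hO⟩
    · exact ⟨_, ⟨_, Or.inr ⟨_, ⟨z, hz, rfl⟩, rfl⟩, rfl⟩, hO⟩

end Countable

lemma measurable_assemble (t : PosReal) : Measurable (assemble t) := by
  refine measurable_closedSets fun O hO => ?_
  have hc : ∀ n : ℕ, Continuous fun p : ℝ × Unit => (p.1, n) := fun n => by fun_prop
  have h : {Z : ℕ → ClosedSets Unit t | ((assemble t Z).carrier ∩ O).Nonempty} =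
      ⋃ n, {Z | ((Z n).carrier ∩ (fun p : ℝ × Unit => (p.1, n)) ⁻¹' O).Nonempty} := by
    ext Z
    simp only [Set.mem_ofPred_eq, Set.mem_iUnion]
    constructor
    · rintro ⟨⟨x, n⟩, hx, hxO⟩
      exact ⟨n, (x, ()), hx, hxO⟩
    · rintro ⟨n, ⟨x, u⟩, hx, hxO⟩
      exact ⟨(x, n), hx, hxO⟩
  rw [h]
  exact MeasurableSet.iUnion fun n =>
    (measurable_pi_apply n : Measurable fun Z : ℕ → ClosedSets Unit t => Z n)
      (measurableSet_hit t (hO.preimage (hc n)))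

end Fell

/-! ### Infinite products: pairing coordinates and dependence on parameters. -/

section InfiniteProducts

variable {X : ℕ → Type*} [∀ n, MeasurableSpace (X n)]

lemma isPiSystem_measurableBoxes :
    IsPiSystem (squareCylinders fun n => {s : Set (X n) | MeasurableSet s}) :=
  isPiSystem_squareCylinders (fun _ => MeasurableSpace.isPiSystem_measurableSet)
    fun _ => MeasurableSet.univ

lemma univ_mem_measurableBoxes :
    Set.univ ∈ squareCylinders fun n => {s : Set (X n) | MeasurableSet s} :=
  ⟨∅, fun _ => Set.univ, fun _ _ => MeasurableSet.univ, by simp⟩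

lemma prod_infinitePi {Y : ℕ → Type*} [∀ n, MeasurableSpace (Y n)]
    (μ : ∀ n, Measure (X n)) (ν : ∀ n, Measure (Y n)) [∀ n, IsProbabilityMeasure (μ n)]
    [∀ n, IsProbabilityMeasure (ν n)] :
    (Measure.infinitePi μ).prod (Measure.infinitePi ν) =
      (Measure.infinitePi fun n => (μ n).prod (ν n)).map
        fun z => (fun n => (z n).1, fun n => (z n).2) := by
  classical
  refine Measure.prod_eq_generateFrom generateFrom_squareCylinders generateFrom_squareCylinders
    isPiSystem_measurableBoxes isPiSystem_measurableBoxes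
    ⟨fun _ => Set.univ, fun _ => univ_mem_measurableBoxes, fun _ => measure_lt_top _ _,
      Set.iUnion_const _⟩
    ⟨fun _ => Set.univ, fun _ => univ_mem_measurableBoxes, fun _ => measure_lt_top _ _,
      Set.iUnion_const _⟩ ?_
  rintro _ ⟨s, A, hA, rfl⟩ _ ⟨t, B, hB, rfl⟩
  have hA' : ∀ n, MeasurableSet (A n) := fun n => hA n trivial
  have hB' : ∀ n, MeasurableSet (B n) := fun n => hB n trivial
  -- Padding with the whole space puts both boxes over the common index set `s ∪ t`.
  let A' : ∀ n, Set (X n) := fun n => if n ∈ s then A n else Set.univ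
  let B' : ∀ n, Set (Y n) := fun n => if n ∈ t then B n else Set.univ
  have mA : ∀ n, MeasurableSet (A' n) := fun n => by
    simp only [A']
    split_ifs
    exacts [hA' n, .univ]
  have mB : ∀ n, MeasurableSet (B' n) := fun n => by
    simp only [B']
    split_ifs
    exacts [hB' n, .univ]
  have h : (fun z : ∀ n, X n × Y n => ((fun n => (z n).1, fun n => (z n).2) :
        (∀ n, X n) × (∀ n, Y n))) ⁻¹' (Set.pi (s : Set ℕ) A ×ˢ Set.pi (t : Set ℕ) B) =
      Set.pi ((s ∪ t : Finset ℕ) : Set ℕ) fun n => A' n ×ˢ B' n := by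
    ext z
    simp only [Set.mem_preimage, Set.mem_prod, Set.mem_pi, Finset.mem_coe, Finset.mem_union,
      A', B']
    constructor
    · rintro ⟨h₁, h₂⟩ n -
      split_ifs with hs ht ht
      exacts [⟨h₁ n hs, h₂ n ht⟩, ⟨h₁ n hs, trivial⟩, ⟨trivial, h₂ n ht⟩, ⟨trivial, trivial⟩]
    · refine fun h => ⟨fun n hn => ?_, fun n hn => ?_⟩
      · simpa only [if_pos hn] using (h n (Or.inl hn)).1
      · simpa only [if_pos hn] using (h n (Or.inr hn)).2
  rw [Measure.map_apply (by fun_prop) ((MeasurableSet.pi s.countable_toSet fun n _ => hA' n).prod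
      (MeasurableSet.pi t.countable_toSet fun n _ => hB' n)), h,
    Measure.infinitePi_pi _ fun n _ => (mA n).prod (mB n), Measure.infinitePi_pi _ fun n _ => hA' n,
    Measure.infinitePi_pi _ fun n _ => hB' n]
  simp_rw [Measure.prod_prod]
  rw [Finset.prod_mul_distrib]
  congr 1
  · rw [← Finset.prod_subset Finset.subset_union_left]
    · exact Finset.prod_congr rfl fun n hn => by simp only [A', if_pos hn]
    · intro n _ hn
      simp only [A', if_neg hn, measure_univ]
  · rw [← Finset.prod_subset Finset.subset_union_right]
    · exact Finset.prod_congr rfl fun n hn => by simp only [B', if_pos hn]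
    · intro n _ hn
      simp only [B', if_neg hn, measure_univ]

lemma measurable_infinitePi {α : Type*} [MeasurableSpace α] {κ : ∀ n, α → Measure (X n)}
    [∀ n a, IsProbabilityMeasure (κ n a)] (hκ : ∀ n, Measurable (κ n)) :
    Measurable fun a => Measure.infinitePi fun n => κ n a := by
  refine Measurable.measure_of_isPiSystem_of_isProbabilityMeasure
    generateFrom_squareCylinders.symm
    isPiSystem_measurableBoxes ?_
  rintro _ ⟨s, t, ht, rfl⟩
  have ht' : ∀ n, MeasurableSet (t n) := fun n => ht n trivial
  simp_rw [Measure.infinitePi_pi _ fun n (_ : n ∈ s) => ht' n]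
  exact Finset.measurable_prod _ fun n _ => (Measure.measurable_coe (ht' n)).comp (hκ n)

end InfiniteProducts

/-! ### Compatibility of the set operations, and measurable densities. -/

section Families

open ClosedSets ProbabilityTheory

variable {L : Type*} [TopologicalSpace L]

lemma rescale_rescale (s t u : PosReal) (Z : ClosedSets L s) :
    rescale t u (rescale s t Z) = rescale s u Z := by
  ext1
  have ht := t.2.ne'
  simp only [rescale, Set.image_image]
  congr 1
  funext p
  rw [← mul_assoc, div_mul_div_cancel₀ ht]

lemma rescale_self (t : PosReal) (Z : ClosedSets L t) : rescale t t Z = Z := by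
  ext1
  simp [rescale, div_self t.2.ne']

/-- All three rescalings have the same ratio `b⁻¹`, and a dilation is additive in time. -/
lemma rescale_concat (b s t : PosReal) (Z : ClosedSets L (b * s) × ClosedSets L (b * t)) :
    rescale (b * s + b * t) (s + t) (concat (b * s) (b * t) Z) =
      concat s t (rescale (b * s) s Z.1, rescale (b * t) t Z.2) := by
  have hb := b.2.ne'
  have hs := s.2.ne'
  have ht := t.2.ne'
  have hst : (s : ℝ) + t ≠ 0 := (add_pos s.2 t.2).ne'
  have hbs : ((b * s : PosReal) : ℝ) = b * s := rfl
  have hbt : ((b * t : PosReal) : ℝ) = b * t := rfl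
  have h : ((s + t : PosReal) : ℝ) / ((b * s + b * t : PosReal) : ℝ) = (b : ℝ)⁻¹ := by
    push_cast
    rw [hbs, hbt]
    field_simp
  have h₁ : (s : ℝ) / ((b * s : PosReal) : ℝ) = (b : ℝ)⁻¹ := by
    rw [hbs]
    field_simp
  have h₂ : (t : ℝ) / ((b * t : PosReal) : ℝ) = (b : ℝ)⁻¹ := by
    rw [hbt]
    field_simp
  ext1
  simp only [rescale, concat, Set.image_union, Set.image_image, h, h₁, h₂]
  congr 2
  funext p
  rw [hbs, mul_add, inv_mul_cancel_left₀ hb]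

lemma assemble_concat (s t : PosReal) (Z : ℕ → ClosedSets Unit s × ClosedSets Unit t) :
    assemble (s + t) (fun n => concat s t (Z n)) =
      concat s t (assemble s fun n => (Z n).1, assemble t fun n => (Z n).2) := by
  ext ⟨x, n⟩
  simp [assemble, concat, and_comm, Unique.exists_iff (α := Unit)]

lemma assemble_rescale (s t : PosReal) (Z : ℕ → ClosedSets Unit s) :
    assemble t (fun n => rescale s t (Z n)) = rescale s t (assemble s Z) := by
  ext ⟨x, n⟩
  simp [assemble, rescale, and_comm, Unique.exists_iff (α := Unit)]

lemma MeasEquiv.map {X Y : Type*} [MeasurableSpace X] [MeasurableSpace Y] {μ ν : Measure X}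
    (h : MeasEquiv μ ν) {f : X → Y} (hf : Measurable f) : MeasEquiv (μ.map f) (ν.map f) :=
  ⟨h.1.map hf, h.2.map hf⟩

section Countable

variable [SecondCountableTopology L] [LocallyCompactSpace L] [T2Space L]

/-- Rescaling as an isomorphism of measurable spaces. -/
def rescaleEquiv (s t : PosReal) : ClosedSets L s ≃ᵐ ClosedSets L t where
  toFun := rescale s t
  invFun := rescale t s
  left_inv Z := by rw [rescale_rescale, rescale_self]
  right_inv Z := by rw [rescale_rescale, rescale_self]
  measurable_toFun := measurable_rescale s t
  measurable_invFun := measurable_rescale t s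

lemma map_rescale_map_rescale (s t u : PosReal) (μ : Measure (ClosedSets L s)) :
    (μ.map (rescale s t)).map (rescale t u) = μ.map (rescale s u) := by
  rw [Measure.map_map (measurable_rescale t u) (measurable_rescale s t)]
  congr 1
  exact funext fun Z => rescale_rescale s t u Z

instance instIsProbabilityMeasureConcatLaw (μ : ∀ t : PosReal, Measure (ClosedSets L t))
    [∀ t, IsProbabilityMeasure (μ t)] (s t : PosReal) :
    IsProbabilityMeasure (concatLaw μ s t) :=
  Measure.isProbabilityMeasure_map (measurable_concat s t).aemeasurable

lemma measurable_add_posReal : Measurable fun p : PosReal × PosReal => p.1 + p.2 :=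
  ((measurable_subtype_coe.comp measurable_fst).add
    (measurable_subtype_coe.comp measurable_snd)).subtype_mk

lemma measurable_mul_posReal (b : PosReal) : Measurable fun t : PosReal => b * t :=
  (measurable_subtype_coe.const_mul (b : ℝ)).subtype_mk

/-- In a factorizing family with measurable laws the derivatives have a positive, finite, jointly
measurable version. -/
theorem exists_measurable_derivatives {μ : ∀ t : PosReal, Measure (ClosedSets L t)}
    [∀ t, IsProbabilityMeasure (μ t)] (hμ : ∀ s t, MeasEquiv (μ (s + t)) (concatLaw μ s t))
    (hmeas : Measurable fun t : PosReal => (μ t).map (rescale t 1)) :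
    ∃ Δ : (PosReal × PosReal) × ClosedSets L 1 → PosReal, Measurable Δ ∧
      ∀ s t : PosReal, ∀ᵐ Z ∂(μ (s + t)),
        ENNReal.ofReal (Δ ((s, t), rescale (s + t) 1 Z) : ℝ) =
          (concatLaw μ s t).rnDeriv (μ (s + t)) Z := by
  have hprob : ∀ t, IsProbabilityMeasure ((μ t).map (rescale t 1)) := fun t =>
    Measure.isProbabilityMeasure_map (measurable_rescale t 1).aemeasurable
  let κ : Kernel PosReal (ClosedSets L 1) := ⟨fun t => (μ t).map (rescale t 1), hmeas⟩
  have : IsMarkovKernel κ := ⟨hprob⟩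
  -- The spaces of closed sets vary with `s + t`; transport to `[0,1]` puts both laws on one space,
  -- as kernels in `(s, t)`. In `A` the factor `Kernel.id` keeps `(s, t)` available to the map,
  -- which depends on it.
  let B : Kernel (PosReal × PosReal) (ClosedSets L 1) :=
    κ.comap (fun p => p.1 + p.2) measurable_add_posReal
  let A : Kernel (PosReal × PosReal) (ClosedSets L 1) :=
    (Kernel.id ×ₖ (κ.comap Prod.fst measurable_fst ×ₖ κ.comap Prod.snd measurable_snd)).map
      fun q => rescale (q.1.1 + q.1.2) 1
        (concat q.1.1 q.1.2 (rescale 1 q.1.1 q.2.1, rescale 1 q.1.2 q.2.2))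
  have : IsMarkovKernel A := Kernel.IsMarkovKernel.map _ measurable_rescale_concat_rescale
  have hB : ∀ s t, B (s, t) = (μ (s + t)).map (rescaleEquiv (s + t) 1) := fun s t => rfl
  have hA : ∀ s t, A (s, t) = (concatLaw μ s t).map (rescaleEquiv (s + t) 1) := by
    intro s t
    have h1 : A (s, t) = ((Measure.dirac (s, t)).prod
        (((μ s).map (rescale s 1)).prod ((μ t).map (rescale t 1)))).map
        fun q => rescale (q.1.1 + q.1.2) 1
          (concat q.1.1 q.1.2 (rescale 1 q.1.1 q.2.1, rescale 1 q.1.2 q.2.2)) := by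
      rw [Kernel.map_apply _ measurable_rescale_concat_rescale, Kernel.prod_apply,
        Kernel.prod_apply]
      rfl
    rw [h1, Measure.dirac_prod, Measure.map_prod_map _ _ (measurable_rescale s 1)
      (measurable_rescale t 1), Measure.map_map measurable_rescale_concat_rescale (by fun_prop),
      Measure.map_map (measurable_rescale_concat_rescale.comp (by fun_prop))
        ((measurable_rescale s 1).prodMap (measurable_rescale t 1)), concatLaw,
      Measure.map_map (rescaleEquiv (s + t) 1).measurable (measurable_concat s t)]
    congr 1
    funext Z
    simp only [Function.comp_apply, Prod.map, rescale_rescale, rescale_self]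
    rfl
  have hd := Kernel.measurable_rnDeriv A B
  -- The default `1` covers derivative values `0` and `∞` (where `toReal` vanishes). Both are
  -- negligible: the derivative is almost everywhere finite, and positive because `μ (s + t)` is
  -- absolutely continuous with respect to the concatenation law.
  refine ⟨fun q => ⟨if 0 < (Kernel.rnDeriv A B q.1 q.2).toReal
    then (Kernel.rnDeriv A B q.1 q.2).toReal else 1, ?_⟩, ?_, fun s t => ?_⟩
  · split_ifs with h
    exacts [h, one_pos]
  · refine Measurable.subtype_mk ?_
    exact Measurable.ite (measurableSet_lt measurable_const hd.ennreal_toReal) hd.ennreal_toReal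
      measurable_const
  · have h1 : ∀ᵐ Z ∂((μ (s + t)).map (rescaleEquiv (s + t) 1)), Kernel.rnDeriv A B (s, t) Z =
        (A (s, t)).rnDeriv (B (s, t)) Z := Kernel.rnDeriv_eq_rnDeriv_measure
    have h2 := ae_of_ae_map (rescaleEquiv (s + t) 1).measurable.aemeasurable h1
    have h3 := (rescaleEquiv (s + t) 1).measurableEmbedding.rnDeriv_map
      (concatLaw μ s t) (μ (s + t))
    filter_upwards [h2, h3, Measure.rnDeriv_pos' (hμ s t).1,
      Measure.rnDeriv_lt_top (concatLaw μ s t) (μ (s + t))] with Z h2 h3 h4 h5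
    have h6 : Kernel.rnDeriv A B (s, t) (rescale (s + t) 1 Z) =
        (concatLaw μ s t).rnDeriv (μ (s + t)) Z := by
      rw [← h3, ← hA, ← hB]
      exact h2
    simp only [h6]
    rw [if_pos (ENNReal.toReal_pos h4.ne' h5.ne), ENNReal.ofReal_toReal h5.ne]

end Countable

end Families

/-! ### The axioms for the marked product. -/

section MarkedProducts

open ClosedSets

variable {ν : ∀ t : PosReal, Measure (ClosedSets Unit t)}

instance instIsProbabilityMeasureDilatedCopy [∀ t, IsProbabilityMeasure (ν t)] (b t : PosReal) :
    IsProbabilityMeasure (dilatedCopy ν b t) :=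
  Measure.isProbabilityMeasure_map (measurable_rescale _ t).aemeasurable

instance instIsProbabilityMeasureMarkedProduct [∀ t, IsProbabilityMeasure (ν t)]
    (a : ℕ → PosReal) (t : PosReal) : IsProbabilityMeasure (markedProduct ν a t) :=
  Measure.isProbabilityMeasure_map (measurable_assemble t).aemeasurable

lemma dilatedCopy_add (ν : ∀ t : PosReal, Measure (ClosedSets Unit t)) (b s t : PosReal) :
    dilatedCopy ν b (s + t) =
      (ν (b * s + b * t)).map (rescaleEquiv (b * s + b * t) (s + t)) := by
  -- The times `b * (s + t)` and `b * s + b * t` index different types, so their equality is used by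
  -- substitution for a variable.
  have h : ∀ u v : PosReal, u = v →
      (ν u).map (rescale u (s + t)) = (ν v).map (rescale v (s + t)) := by
    rintro u _ rfl
    rfl
  exact h _ _ (Subtype.ext (mul_add (b : ℝ) s t))

lemma concatLaw_dilatedCopy [∀ t, IsProbabilityMeasure (ν t)] (b s t : PosReal) :
    concatLaw (dilatedCopy ν b) s t =
      (concatLaw ν (b * s) (b * t)).map (rescaleEquiv (b * s + b * t) (s + t)) := by
  unfold concatLaw dilatedCopy
  rw [Measure.map_prod_map _ _ (measurable_rescale _ s) (measurable_rescale _ t),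
    Measure.map_map (measurable_concat s t)
      ((measurable_rescale _ s).prodMap (measurable_rescale _ t)),
    Measure.map_map (MeasurableEquiv.measurable _) (measurable_concat _ _)]
  congr 1
  funext Z
  exact (rescale_concat b s t Z).symm

lemma hellingerAffinity_dilatedCopy [∀ t, IsProbabilityMeasure (ν t)] (b s t : PosReal) :
    hellingerAffinity (dilatedCopy ν b (s + t)) (concatLaw (dilatedCopy ν b) s t) =
      hellinger ν (b * s) (b * t) := by
  rw [dilatedCopy_add, concatLaw_dilatedCopy, hellingerAffinity_map_equiv]
  rfl

lemma measEquiv_dilatedCopy [∀ t, IsProbabilityMeasure (ν t)]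
    (h : ∀ s t, MeasEquiv (ν (s + t)) (concatLaw ν s t)) (b s t : PosReal) :
    MeasEquiv (dilatedCopy ν b (s + t)) (concatLaw (dilatedCopy ν b) s t) := by
  rw [dilatedCopy_add, concatLaw_dilatedCopy]
  exact (h _ _).map (MeasurableEquiv.measurable _)

lemma concatLaw_markedProduct [∀ t, IsProbabilityMeasure (ν t)] (a : ℕ → PosReal)
    (s t : PosReal) : concatLaw (markedProduct ν a) s t =
      (Measure.infinitePi fun n => concatLaw (dilatedCopy ν (a n)) s t).map
        (assemble (s + t)) := by
  have hm : Measurable fun (Z : ℕ → ClosedSets Unit s × ClosedSets Unit t) n =>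
      concat s t (Z n) :=
    measurable_pi_lambda _ fun n => (measurable_concat s t).comp (measurable_pi_apply n)
  unfold concatLaw markedProduct
  rw [Measure.map_prod_map _ _ (measurable_assemble s) (measurable_assemble t), prod_infinitePi,
    ← Measure.infinitePi_map_pi _ fun n => measurable_concat s t,
    Measure.map_map (measurable_concat s t)
      ((measurable_assemble s).prodMap (measurable_assemble t)),
    Measure.map_map ((measurable_concat s t).comp
      ((measurable_assemble s).prodMap (measurable_assemble t))) (by fun_prop),
    Measure.map_map (measurable_assemble _) hm]
  congr 1
  funext Z
  exact (assemble_concat s t Z).symm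

/-- Square summability forces `a n` below the threshold `ε` eventually, and there the bound with `λ
= a n` applies. -/
lemma summable_one_sub_hellinger [∀ t, IsProbabilityMeasure (ν t)]
    (h : ∀ s t, MeasEquiv (ν (s + t)) (concatLaw ν s t)) (hsmall : HellingerSmall ν)
    {a : ℕ → PosReal} (ha : Summable fun n => (a n : ℝ) ^ 2) (s t : PosReal) :
    Summable fun n => 1 - hellinger ν (a n * s) (a n * t) := by
  obtain ⟨C, ε, hC⟩ := hsmall s t
  refine Summable.of_norm_bounded_eventually_nat (ha.mul_left C) ?_
  have h0 : ∀ᶠ n in Filter.atTop, (a n : ℝ) ^ 2 < (ε : ℝ) ^ 2 :=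
    ha.tendsto_atTop_zero.eventually_lt_const (pow_pos ε.2 2)
  filter_upwards [h0] with n hn
  have hlt : (a n : ℝ) < ε := lt_of_pow_lt_pow_left₀ 2 ε.2.le hn
  have hle : hellinger ν (a n * s) (a n * t) ≤ 1 := hellingerAffinity_le_one (h _ _).1
  rw [Real.norm_of_nonneg (sub_nonneg.2 hle)]
  exact hC _ hlt

theorem measEquiv_markedProduct [∀ t, IsProbabilityMeasure (ν t)]
    (h : ∀ s t, MeasEquiv (ν (s + t)) (concatLaw ν s t)) (hsmall : HellingerSmall ν)
    {a : ℕ → PosReal} (ha : Summable fun n => (a n : ℝ) ^ 2) (s t : PosReal) :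
    MeasEquiv (markedProduct ν a (s + t)) (concatLaw (markedProduct ν a) s t) := by
  rw [concatLaw_markedProduct]
  refine (measEquiv_infinitePi (fun n => measEquiv_dilatedCopy h (a n) s t) ?_).map
    (measurable_assemble _)
  simpa only [hellingerAffinity_dilatedCopy] using summable_one_sub_hellinger h hsmall ha s t

lemma markedProduct_no_time_slices [∀ t, IsProbabilityMeasure (ν t)]
    (h : ∀ (t : PosReal), ∀ r ∈ Set.Icc (0 : ℝ) (t : ℝ),
      ν t {Z | (Z.carrier ∩ ({r} ×ˢ Set.univ)).Nonempty} = 0)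
    (a : ℕ → PosReal) (t : PosReal) {r : ℝ} (hr : r ∈ Set.Icc (0 : ℝ) (t : ℝ)) :
    markedProduct ν a t {Z | (Z.carrier ∩ ({r} ×ˢ Set.univ)).Nonempty} = 0 := by
  have hS : {Z : ClosedSets ℕ t | (Z.carrier ∩ ({r} ×ˢ Set.univ)).Nonempty} ⊆
      ⋃ n, {Z | (r, n) ∈ Z.carrier} := by
    rintro Z ⟨⟨x, n⟩, hZ, hx, -⟩
    obtain rfl : x = r := hx
    exact Set.mem_iUnion.2 ⟨n, hZ⟩
  refine measure_mono_null hS (measure_iUnion_null fun n => ?_)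
  -- The slice at `r` in the dilated copy is the slice of the original set at `a n * r`.
  have h1 : dilatedCopy ν (a n) t {W | (r, ()) ∈ W.carrier} = 0 := by
    rw [dilatedCopy, Measure.map_apply (measurable_rescale _ t) (measurableSet_mem_carrier t _)]
    refine measure_mono_null ?_ (h (a n * t) (a n * r) ⟨mul_nonneg (a n).2.le hr.1,
      mul_le_mul_of_nonneg_left hr.2 (a n).2.le⟩)
    rintro V ⟨⟨x, u⟩, hx, hxr⟩
    refine ⟨(x, u), hx, ?_, trivial⟩
    have hxr' : (t : ℝ) / ((a n : ℝ) * t) * x = r := congr_arg Prod.fst hxr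
    have ha := (a n).2.ne'
    have ht := t.2.ne'
    rw [Set.mem_singleton_iff, ← hxr']
    field_simp
  rw [markedProduct, Measure.map_apply (measurable_assemble t) (measurableSet_mem_carrier t _)]
  rw [← Measure.infinitePi_map_eval (fun n => dilatedCopy ν (a n) t) n] at h1
  exact Measure.preimage_null_of_map_null (measurable_pi_apply n).aemeasurable h1

lemma markedProduct_nondegenerate [∀ t, IsProbabilityMeasure (ν t)]
    (h : ∀ (t : PosReal) (F : Set (ClosedSets Unit t)), F.Finite → ν t Fᶜ ≠ 0)
    (a : ℕ → PosReal) (t : PosReal) {F : Set (ClosedSets ℕ t)} (hF : F.Finite) :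
    markedProduct ν a t Fᶜ ≠ 0 := by
  intro h0
  -- `p` reads off the mark `0`. A finite support for the assembled set would leave finitely many
  -- values for its slice at mark `0`, hence a finite support for `ν (a 0 * t)`.
  let p : ClosedSets ℕ t → Set (ℝ × Unit) := fun Z => {x | (x.1, 0) ∈ Z.carrier}
  have hp : ∀ Z : ℕ → ClosedSets Unit t, p (assemble t Z) = (Z 0).carrier := fun Z => rfl
  have hG : {W : ClosedSets Unit t | W.carrier ∈ p '' F}.Finite :=
    (hF.image p).preimage fun W _ W' _ hWW' => ClosedSets.ext hWW'
  have h1 := Measure.preimage_null_of_map_null (measurable_assemble t).aemeasurable h0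
  have h2 : dilatedCopy ν (a 0) t {W | W.carrier ∈ p '' F}ᶜ = 0 := by
    rw [← Measure.infinitePi_map_eval (fun n => dilatedCopy ν (a n) t) 0,
      Measure.map_apply (measurable_pi_apply 0) hG.measurableSet.compl]
    refine measure_mono_null (t := assemble t ⁻¹' Fᶜ) (fun Z hZ hZF => hZ ?_) h1
    exact ⟨assemble t Z, hZF, hp Z⟩
  have h3 := Measure.preimage_null_of_map_null (measurable_rescale _ t).aemeasurable h2
  refine h (a 0 * t) _ (hG.preimage ?_) h3
  exact (rescaleEquiv (a 0 * t) t).injective.injOn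

/-- A ring of sets is a π-system, so measurability on generators extends to the whole law as a
measure-valued map. -/
lemma measurable_map_rescale {R : Set (Set (ClosedSets Unit 1))}
    [∀ t, IsProbabilityMeasure (ν t)] (hR : IsSetRing R)
    (hgen : MeasurableSpace.generateFrom R = (inferInstance : MeasurableSpace (ClosedSets Unit 1)))
    (h : ∀ A ∈ R, Measurable fun t : PosReal => (ν t).map (rescale t 1) A) :
    Measurable fun t : PosReal => (ν t).map (rescale t 1) := by
  have : ∀ t, IsProbabilityMeasure ((ν t).map (rescale t 1)) := fun t =>
    Measure.isProbabilityMeasure_map (measurable_rescale t 1).aemeasurable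
  exact Measurable.measure_of_isPiSystem_of_isProbabilityMeasure hgen.symm
    (fun A hA B hB _ => hR.inter_mem hA hB) h

lemma measurable_map_rescale_markedProduct [∀ t, IsProbabilityMeasure (ν t)]
    (h : Measurable fun t : PosReal => (ν t).map (rescale t 1)) (a : ℕ → PosReal) :
    Measurable fun t : PosReal => (markedProduct ν a t).map (rescale t 1) := by
  have : ∀ t, IsProbabilityMeasure ((ν t).map (rescale t 1)) := fun t =>
    Measure.isProbabilityMeasure_map (measurable_rescale t 1).aemeasurable
  -- After rescaling, the `n`-th factor is the `[0,1]`-law of `ν` at time `a n * t`, so its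
  -- dependence on `t` is that of `ν` composed with a multiplication.
  have heq : ∀ t, (markedProduct ν a t).map (rescale t 1) = (Measure.infinitePi fun n =>
      (ν (a n * t)).map (rescale (a n * t) 1)).map (assemble 1) := by
    intro t
    have hm : Measurable fun (Z : ℕ → ClosedSets Unit t) n => rescale t 1 (Z n) :=
      measurable_pi_lambda _ fun n => (measurable_rescale t 1).comp (measurable_pi_apply n)
    have h1 : (fun n => (ν (a n * t)).map (rescale (a n * t) 1)) =
        fun n => (dilatedCopy ν (a n) t).map (rescale t 1) :=
      funext fun n => (map_rescale_map_rescale _ t 1 _).symm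
    rw [h1, ← Measure.infinitePi_map_pi _ fun n => measurable_rescale t 1, markedProduct,
      Measure.map_map (measurable_rescale t 1) (measurable_assemble t),
      Measure.map_map (measurable_assemble 1) hm]
    congr 1
    funext Z
    exact (assemble_rescale t 1 Z).symm
  simp_rw [heq]
  exact (Measure.measurable_map _ (measurable_assemble 1)).comp
    (measurable_infinitePi fun n => h.comp (measurable_mul_posReal (a n)))

end MarkedProducts

theorem mainTheorem7
    (ν : ∀ t : PosReal, Measure (ClosedSets Unit t))
    (hν : IsMeasurableFactorizingFamily ν) (hsmall : HellingerSmall ν)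
    (a : ℕ → PosReal) (ha : Summable fun n => (a n : ℝ) ^ 2) :
    IsMeasurableFactorizingFamily (markedProduct ν a) := by
  have := hν.isProbabilityMeasure
  obtain ⟨R, -, hR, hgen, hRmeas⟩ := hν.measurable_laws
  have hmeas := measurable_map_rescale_markedProduct (measurable_map_rescale hR hgen hRmeas) a
  have hequiv := measEquiv_markedProduct hν.factorization hsmall ha
  refine ⟨⟨fun t => inferInstance, hequiv,
    fun t r hr => markedProduct_no_time_slices hν.no_time_slices a t hr⟩,
    fun t F hF => markedProduct_nondegenerate hν.nondegenerate a t hF,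
    -- The laws are measurable in `t` on every measurable set, so any countable generating ring
    -- serves; this one comes from second countability of the Fell topology.
    ⟨generateSetAlgebra (MeasurableSpace.countableGeneratingSet (ClosedSets ℕ 1)),
      countable_generateSetAlgebra (MeasurableSpace.countable_countableGeneratingSet),
      isSetAlgebra_generateSetAlgebra.isSetRing, ?_, fun A hA => ?_⟩,
    exists_measurable_derivatives hequiv hmeas⟩
  · rw [generateFrom_generateSetAlgebra_eq, MeasurableSpace.generateFrom_countableGeneratingSet]
  · refine (Measure.measurable_coe ?_).comp hmeas
    rw [← MeasurableSpace.generateFrom_countableGeneratingSet (α := ClosedSets ℕ 1),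
      ← generateFrom_generateSetAlgebra_eq]
    exact MeasurableSpace.measurableSet_generateFrom hA
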